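/- Let $T:[0,1)\to[0,1)$ be the Gauss map, $T(0)=0$ and $T(x)=1/x-\lfloor 1/x\rfloor$ for $x\ne 0$, and let $a_n(x)=\lfloor 1/T^{n-1}x\rfloor$ ($n\ge 1$) be the partial quotients of $x$, defined as long as $T^{n-1}x\neq 0$. Write $[a_1,\dots,a_n+x]=1/(a_1+1/(a_2+\dots+1/(a_n+x)))$, and let $q_n(a_1,\dots,a_n)$ be given by $q_{-1}=0$, $q_0=1$, $q_{k+1}=a_{k+1}q_k+q_{k-1}$. For a set $\mathcal A$ of positive integers let $Y_{\mathcal A}$ be the set of $x\in[0,1)$ all of whose partial quotients $a_n(x)$, $n\ge1$, are defined and lie in $\mathcal A$, and for $\varphi:[0,1)\to\mathbb R$ with ergodic sums $S_n\varphi=\varphi+\varphi\circ T+\dots+\varphi\circ T^{n-1}$ let $$\mathsf P_{\mathcal A}(T,\varphi)=\lim_{n\to\infty}\frac1n\log\sum_{a_1,\dots,a_n\in\mathcal A}\ \sup_{x\in Y_{\mathcal A}}e^{S_n\varphi([a_1,\dots,a_n+x])}\in[-\infty,\infty].$$ For $1<B<\infty$ and $n\ge 1$ put $$t_{n,B}(\mathcal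 A)=\inf\Big\{s\ge0:\sum_{a_1,\dots,a_n\in\mathcal A}\Big(\frac1{B^{ns}q_n(a_1,\dots,a_n)^2}\Big)^s\le1\Big\},$$ $$t_B(\mathcal A)=\inf\{s\ge0:\mathsf P_{\mathcal A}(T,-s(s\log B+\log|T'|))\le0\}.$$ For an integer $M\ge1$ write $t_{n,B}(M)$ and $t_B(M)$ for these numbers with $\mathcal A=\{1,\dots,M\}$, and $t_B$ for $t_B(\mathcal A)$ with $\mathcal A$ the set of all positive integers. Then all these quantities are well defined: for all $1<B<\infty$ and $s\ge0$, the limit defining $\mathsf P_{\mathcal A}(T,-s(s\log B+\log|T'|))$ exists in $[-\infty,\infty]$ for $\mathcal A=\{1,\dots,M\}$ ($M\ge1$) and for $\mathcal A$ the set of all positive integers, and the infima defining $t_{n,B}(M)$, $t_B(M)$ ($n,M\ge1$) and $t_B$ are taken over non-empty sets. Moreover, for every $1<B<\infty$ and every integer $M\ge1$, $$\lim_{n\to\infty}t_{n,B}(M)=t_B(M),\qquad \lim_{M\to\infty}t_B(M)=t_B;$$ the function $B\mapsto t_B$ is continuous on $(1,\infty)$, and $$\lim_{B\to1^+}t_B=1,\qquad\lim_{B\to\infty}t_B=\frac12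 .$$ -/

import Mathlib

open Filter Topology

noncomputable section

namespace CFPressure

/-- The Gauss map `T x = 1/x mod 1`, with `T 0 = 0`. -/
def gaussMap (x : ℝ) : ℝ := Int.fract (1 / x)

/-- `partialQuotient x n` is the partial quotient `a_{n+1}(x) = ⌊1 / Tⁿ x⌋` (so `n = 0` gives `a₁`).
If the expansion of `x` has stopped, that is `Tⁿ x = 0`, the value is `0`, which is not a digit. -/
def partialQuotient (x : ℝ) (n : ℕ) : ℕ := ⌊1 / (gaussMap^[n] x)⌋₊

/-- `Y_A`: the points of `[0,1)` all of whose partial quotients exist and lie in `A`, for an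
alphabet `A` of positive integers. -/
def digitSet (A : Set ℕ) : Set ℝ :=
  {x | x ∈ Set.Ico (0 : ℝ) 1 ∧ ∀ n : ℕ, partialQuotient x n ∈ A}

/-- `[a₁, …, aₙ + x] = 1 / (a₁ + 1 / (a₂ + ⋯ + 1 / (aₙ + x)))`. -/
def cfPoint (l : List ℕ) (x : ℝ) : ℝ := l.foldr (fun a y => 1 / ((a : ℝ) + y)) x

/-- The denominator `qₙ(a₁, …, aₙ)`, from `q₋₁ = 0`, `q₀ = 1`, `q_{k+1} = a_{k+1} q_k + q_{k-1}`;
the running pair is `(q_{k-1}, q_k)`. -/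
def cfDenom (l : List ℕ) : ℕ := (l.foldl (fun p a => (p.2, a * p.2 + p.1)) ((0, 1) : ℕ × ℕ)).2

/-- The partition sum `∑_{a₁,…,aₙ ∈ A} sup_{x ∈ Y_A} exp (Sₙ φ ([a₁, …, aₙ + x]))`. -/
def partitionSum (A : Set ℕ) (φ : ℝ → ℝ) (n : ℕ) : ENNReal :=
  ∑' a : Fin n → A, ⨆ x ∈ digitSet A,
    ENNReal.ofReal (Real.exp
      (birkhoffSum gaussMap φ n (cfPoint (List.ofFn fun i => (a i : ℕ)) x)))

/-- The `n`-th term `(1/n) log ∑ sup exp Sₙ φ` of the sequence whose limit is the pressure. -/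
def pressureSeq (A : Set ℕ) (φ : ℝ → ℝ) (n : ℕ) : EReal :=
  ENNReal.log (partitionSum A φ n) / (n : EReal)

/-- The pressure `P_A(T, φ)`, with values in `[-∞, ∞]`. It is written as an upper limit so as to be
defined for every `φ`; it is the limit whenever the limit exists. -/
def pressure (A : Set ℕ) (φ : ℝ → ℝ) : EReal := limsup (pressureSeq A φ) atTop

/-- The potential `-s (s log B + log |T'|)`. -/
def potential (B s : ℝ) (x : ℝ) : ℝ := -s * (s * Real.log B + Real.log |deriv gaussMap x|)

/-- `gₙ(s) = ∑_{a₁,…,aₙ ∈ A} (1 / (B^{ns} qₙ²))^s`. -/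
def g (A : Set ℕ) (B : ℝ) (n : ℕ) (s : ℝ) : ENNReal :=
  ∑' a : Fin n → A, ENNReal.ofReal
    ((1 / (B ^ ((n : ℝ) * s) * (cfDenom (List.ofFn fun i => (a i : ℕ)) : ℝ) ^ 2)) ^ s)

/-- The set `{s ≥ 0 : gₙ(s) ≤ 1}`. -/
def levelSet (A : Set ℕ) (B : ℝ) (n : ℕ) : Set ℝ := {s | 0 ≤ s ∧ g A B n s ≤ 1}

/-- The set `{s ≥ 0 : P_A(T, -s (s log B + log |T'|)) ≤ 0}`. -/
def pressureSet (A : Set ℕ) (B : ℝ) : Set ℝ := {s | 0 ≤ s ∧ pressure A (potential B s) ≤ 0}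

/-- `t_{n,B}(A)`. -/
def tLevel (A : Set ℕ) (B : ℝ) (n : ℕ) : ℝ := sInf (levelSet A B n)

/-- `t_B(A)`. -/
def tDim (A : Set ℕ) (B : ℝ) : ℝ := sInf (pressureSet A B)

/-- The finite alphabet `{1, …, M}`. -/
def finAlphabet (M : ℕ) : Set ℕ := Set.Icc 1 M

/-- The full alphabet of all positive integers. -/
def fullAlphabet : Set ℕ := Set.Ici 1

end CFPressure

end

noncomputable section

namespace CFPressure

/-! For `x` in `(0,1)`, the chain rule along the orbit of `[a₁, …, aₙ + x]` turns `exp (Sₙ φ)` into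
`B^{-ns²} (qₙ + x q_{n-1})^{-2s}`, which lies within a factor `4^s` of `B^{-ns²} qₙ^{-2s}`. Hence
the pressure is `P(s) - s² log B`, where `P = cfPressure A` is the exponential growth rate of `Zₙ(s)
= cfSum A n s = ∑ qₙ^{-2s}`. Both `t_{n,B}` and `t_B` thus become points where a nonincreasing
function of `s`, namely `(1/n) log Zₙ(s)` or `P(s)`, meets the parabola `s² log B`. As the parabola
is strictly increasing when `log B > 0`, such a `crossing` is stable under pointwise convergence
(`tendsto_crossing_of_tendsto`).

The denominators are multiplicative under concatenation up to a factor 2, so Fekete's lemma used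
from both sides (`exists_tendsto_log_div`) shows that `(1/n) log Zₙ(s)` converges to `P(s)` with
error at most `log (4^s) / n`. This error does not depend on the alphabet, which lets the limits in
`n` and `M` be interchanged (`tendsto_cfPressure_finAlphabet`).

The limits of `t_B` come from three facts on the full alphabet: `P(1) = 0`, because the cylinders of
order `n` have total length 1; `P` falls at rate at least `log 2`; and, for `s ≥ 0`, `P(s) = ∞`
exactly when `s ≤ 1/2`. -/

/-! ### Denominators and their multiplicativity. -/

/-- The pair `(q_{n-1}, q_n)` reached from the initial pair `p` by the recursion for the
denominators. -/
def cfState (l : List ℕ) (p : ℕ × ℕ) : ℕ × ℕ := l.foldl (fun p a => (p.2, a * p.2 + p.1)) p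

/-- The product of `1 / Tᵏ y` along the orbit of `y = [a₁, …, aₙ + x]`. -/
def cfProd : List ℕ → ℝ → ℝ
  | [], _ => 1
  | a :: l, x => (a + cfPoint l x) * cfProd l x

lemma cfState_nil (p : ℕ × ℕ) : cfState [] p = p := rfl

lemma cfState_cons (a : ℕ) (l : List ℕ) (p : ℕ × ℕ) :
    cfState (a :: l) p = cfState l (p.2, a * p.2 + p.1) := rfl

lemma cfState_append (l₁ l₂ : List ℕ) (p : ℕ × ℕ) :
    cfState (l₁ ++ l₂) p = cfState l₂ (cfState l₁ p) := by
  simp [cfState]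

lemma cfDenom_eq (l : List ℕ) : cfDenom l = (cfState l (0, 1)).2 := rfl

lemma cfPoint_nil (x : ℝ) : cfPoint [] x = x := rfl

lemma cfPoint_cons (a : ℕ) (l : List ℕ) (x : ℝ) :
    cfPoint (a :: l) x = 1 / ((a : ℝ) + cfPoint l x) := rfl

lemma cfPoint_nonneg (l : List ℕ) {x : ℝ} (hx : 0 ≤ x) : 0 ≤ cfPoint l x := by
  induction l with
  | nil => exact hx
  | cons a l ih => rw [cfPoint_cons]; positivity

lemma cfPoint_mem_Icc {l : List ℕ} (hl : ∀ a ∈ l, 1 ≤ a) {x : ℝ} (hx : x ∈ Set.Icc (0 : ℝ) 1) :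
    cfPoint l x ∈ Set.Icc (0 : ℝ) 1 := by
  refine ⟨cfPoint_nonneg l hx.1, ?_⟩
  cases l with
  | nil => exact hx.2
  | cons a l =>
    have h1 : (1 : ℝ) ≤ a := by exact_mod_cast hl a (by simp)
    have h2 := cfPoint_nonneg l hx.1
    rw [cfPoint_cons, div_le_one (by linarith)]
    linarith

lemma cfPoint_mem_Ioo {l : List ℕ} (hl : ∀ a ∈ l, 1 ≤ a) {x : ℝ} (hx : x ∈ Set.Ioo (0 : ℝ) 1) :
    cfPoint l x ∈ Set.Ioo (0 : ℝ) 1 := by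
  induction l with
  | nil => exact hx
  | cons a l ih =>
    obtain ⟨h0, -⟩ := ih fun b hb => hl b (by simp [hb])
    have h1 : (1 : ℝ) ≤ a := by exact_mod_cast hl a (by simp)
    rw [cfPoint_cons]
    exact ⟨by positivity, by rw [div_lt_one (by linarith)]; linarith⟩

lemma cfProd_pos {l : List ℕ} (hl : ∀ a ∈ l, 1 ≤ a) {x : ℝ} (hx : 0 ≤ x) : 0 < cfProd l x := by
  induction l with
  | nil => exact one_pos
  | cons a l ih =>
    have h1 : (1 : ℝ) ≤ a := by exact_mod_cast hl a (by simp)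
    have h2 := cfPoint_nonneg l hx
    exact mul_pos (by linarith) (ih fun b hb => hl b (by simp [hb]))

/-- The recursion is linear in the initial pair. Keeping `p` arbitrary lets the induction run, and
later lets a second block start from the state left by the first. -/
lemma cfState_linear {l : List ℕ} (hl : ∀ a ∈ l, 1 ≤ a) {x : ℝ} (hx : 0 ≤ x) (p : ℕ × ℕ) :
    ((cfState l p).2 : ℝ) + x * (cfState l p).1 = cfProd l x * (p.2 + p.1 * cfPoint l x) := by
  induction l generalizing p with
  | nil => simp [cfState_nil, cfProd, cfPoint_nil, mul_comm]
  | cons a l ih =>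
    have h1 : (1 : ℝ) ≤ a := by exact_mod_cast hl a (by simp)
    have h2 := cfPoint_nonneg l hx
    have h3 : (a : ℝ) + cfPoint l x ≠ 0 := by linarith
    rw [cfState_cons, ih (fun b hb => hl b (by simp [hb])), cfProd, cfPoint_cons]
    push_cast
    field_simp
    ring

lemma cfProd_eq {l : List ℕ} (hl : ∀ a ∈ l, 1 ≤ a) {x : ℝ} (hx : 0 ≤ x) :
    cfProd l x = cfDenom l + x * (cfState l (0, 1)).1 := by
  rw [cfDenom_eq, cfState_linear hl hx]
  simp

lemma cfState_fst_le {l : List ℕ} (hl : ∀ a ∈ l, 1 ≤ a) {p : ℕ × ℕ} (hp : p.1 ≤ p.2) :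
    (cfState l p).1 ≤ (cfState l p).2 := by
  induction l generalizing p with
  | nil => exact hp
  | cons a l ih =>
    rw [cfState_cons]
    refine ih (fun b hb => hl b (by simp [hb])) ?_
    have h1 := hl a (by simp)
    dsimp only
    nlinarith

/-- Each digit at least doubles `qₙ (qₙ + q_{n-1})`, the reciprocal of a cylinder length; the worst
digit is 1, which sends `(u, v)` to `(v, v + u)`. -/
lemma two_pow_mul_le_cfState {l : List ℕ} (hl : ∀ a ∈ l, 1 ≤ a) (p : ℕ × ℕ) :
    2 ^ l.length * (p.2 * (p.2 + p.1)) ≤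
      (cfState l p).2 * ((cfState l p).2 + (cfState l p).1) := by
  induction l generalizing p with
  | nil => simp [cfState_nil]
  | cons a l ih =>
    rw [cfState_cons]
    refine le_trans ?_ (ih (fun b hb => hl b (by simp [hb])) _)
    have h1 := hl a (by simp)
    rw [List.length_cons, pow_succ, mul_assoc]
    gcongr 2 ^ l.length * ?_
    obtain ⟨u, v⟩ := p
    have h2 : v ≤ a * v := Nat.le_mul_of_pos_left v h1
    calc 2 * (v * (v + u)) ≤ (v + u) * (v + u + v) := by nlinarith
      _ ≤ (a * v + u) * (a * v + u + v) := by gcongr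

lemma two_pow_le_cfDenom_sq {l : List ℕ} (hl : ∀ a ∈ l, 1 ≤ a) :
    2 ^ l.length ≤ 2 * cfDenom l ^ 2 := by
  have h := two_pow_mul_le_cfState hl (0, 1)
  have h1 : (cfState l (0, 1)).1 ≤ cfDenom l := cfState_fst_le hl (by simp)
  rw [← cfDenom_eq] at h
  simp only [add_zero, mul_one] at h
  nlinarith

lemma cfDenom_pos {l : List ℕ} (hl : ∀ a ∈ l, 1 ≤ a) : 1 ≤ cfDenom l := by
  have h := two_pow_le_cfDenom_sq hl
  have h2 : 0 < 2 ^ l.length := by positivity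
  by_contra hc
  have : cfDenom l = 0 := by omega
  rw [this] at h
  omega

/-- This is `cfState_linear` at `x = 0` for the second block, started from the state of the first.
The bracket lies between `qₘ` and `2 qₘ`, where `qₘ` is the denominator of the first block; this
gives the two bounds below. -/
lemma cfDenom_append {l₁ l₂ : List ℕ} (h₂ : ∀ a ∈ l₂, 1 ≤ a) :
    (cfDenom (l₁ ++ l₂) : ℝ) =
      cfDenom l₂ * (cfDenom l₁ + (cfState l₁ (0, 1)).1 * cfPoint l₂ 0) := by
  have h := cfState_linear h₂ le_rfl (cfState l₁ (0, 1))
  rw [cfProd_eq h₂ le_rfl, ← cfState_append] at h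
  simpa [← cfDenom_eq] using h

lemma cfDenom_mul_le {l₁ l₂ : List ℕ} (h₂ : ∀ a ∈ l₂, 1 ≤ a) :
    (cfDenom l₁ * cfDenom l₂ : ℝ) ≤ cfDenom (l₁ ++ l₂) := by
  rw [cfDenom_append h₂, mul_comm]
  have := cfPoint_nonneg l₂ (le_refl (0 : ℝ))
  gcongr
  exact le_add_of_nonneg_right (by positivity)

lemma cfDenom_append_le {l₁ l₂ : List ℕ} (h₁ : ∀ a ∈ l₁, 1 ≤ a) (h₂ : ∀ a ∈ l₂, 1 ≤ a) :
    (cfDenom (l₁ ++ l₂) : ℝ) ≤ 2 * (cfDenom l₁ * cfDenom l₂) := by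
  have h := cfPoint_mem_Icc h₂ (x := 0) (by simp)
  have h' : ((cfState l₁ (0, 1)).1 : ℝ) ≤ cfDenom l₁ := by
    exact_mod_cast cfState_fst_le h₁ (by simp)
  have h3 : ((cfState l₁ (0, 1)).1 : ℝ) * cfPoint l₂ 0 ≤ cfDenom l₁ * 1 :=
    mul_le_mul h' h.2 h.1 (by positivity)
  rw [cfDenom_append h₂]
  have : (0 : ℝ) ≤ cfDenom l₂ := by positivity
  nlinarith

/-! ### The Gauss map along cylinders -/

lemma gaussMap_one_div {a : ℕ} {y : ℝ} (hy : y ∈ Set.Ico (0 : ℝ) 1) :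
    gaussMap (1 / ((a : ℝ) + y)) = y := by
  rw [gaussMap, one_div_one_div, Int.fract_natCast_add, Int.fract_eq_self.2 hy]

lemma hasDerivAt_gaussMap {a : ℕ} {y : ℝ} (hy : y ∈ Set.Ioo (0 : ℝ) 1) :
    HasDerivAt gaussMap (-((a : ℝ) + y) ^ 2) (1 / ((a : ℝ) + y)) := by
  have h0 : 0 < (a : ℝ) + y := by have := hy.1; positivity
  have h1 : HasDerivAt (fun z : ℝ => 1 / z - a) (-((a : ℝ) + y) ^ 2) (1 / ((a : ℝ) + y)) := by
    have := (hasDerivAt_inv (one_div_pos.2 h0).ne').sub_const (a : ℝ)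
    simpa using this
  refine h1.congr_of_eventuallyEq ?_
  have h2 : Tendsto (fun z : ℝ => 1 / z) (𝓝 (1 / ((a : ℝ) + y))) (𝓝 ((a : ℝ) + y)) := by
    have := (continuousAt_inv₀ (one_div_pos.2 h0).ne').tendsto
    simpa using this
  -- Since `y` is interior, `1 / z` stays in `(a, a + 1)` near the point, so no jump of the floor
  -- interferes.
  filter_upwards [h2.eventually (Ioo_mem_nhds (a := (a : ℝ)) (b := a + 1)
    (by linarith [hy.1]) (by linarith [hy.2]))] with z hz
  rw [gaussMap, Int.fract]
  congr 1
  have : ⌊1 / z⌋ = (a : ℤ) := by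
    rw [Int.floor_eq_iff]
    exact ⟨by simpa using hz.1.le, by simpa using hz.2⟩
  rw [this]
  simp

lemma digitSet_subset {A : Set ℕ} (hA : ∀ a ∈ A, 1 ≤ a) : digitSet A ⊆ Set.Ioo (0 : ℝ) 1 := by
  rintro x ⟨⟨h0, h1⟩, hx⟩
  refine ⟨lt_of_le_of_ne h0 ?_, h1⟩
  rintro rfl
  have := hA _ (hx 0)
  -- With `1 / 0 = 0`, the first quotient of the point 0 is 0, which is not a digit.
  simp [partialQuotient] at this

lemma digitSet_nonempty {A : Set ℕ} (hA : 1 ∈ A) : (digitSet A).Nonempty := by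
  have h5 : 2 < √5 := by
    rw [Real.lt_sqrt] <;> norm_num
  have h5' : √5 < 3 := by
    rw [Real.sqrt_lt'] <;> norm_num
  have hs : √5 * √5 = 5 := Real.mul_self_sqrt (by norm_num)
  -- The fixed point `[1, 1, 1, …]` of the Gauss map: it uses only the digit 1.
  set x : ℝ := (√5 - 1) / 2 with hx
  have hx0 : 0 < x := by rw [hx]; linarith
  have hx1 : x < 1 := by rw [hx]; linarith
  have hinv : 1 / x = (1 : ℕ) + x := by
    rw [div_eq_iff hx0.ne']
    push_cast
    nlinarith
  have hfix : gaussMap x = x := by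
    rw [gaussMap, hinv, Int.fract_natCast_add, Int.fract_eq_self.2 ⟨hx0.le, hx1⟩]
  refine ⟨x, ⟨hx0.le, hx1⟩, fun n => ?_⟩
  rw [partialQuotient, Function.iterate_fixed hfix, hinv]
  have : ⌊((1 : ℕ) : ℝ) + x⌋₊ = 1 := by
    rw [Nat.floor_eq_iff (by positivity)]
    constructor <;> push_cast <;> linarith
  rwa [this]

/-- At a point `1 / (a + y)` one has `|T'| = (a + y)²`, so each orbit step contributes one factor of
`cfProd` to the power `-2s`. -/
lemma exp_birkhoffSum {B s : ℝ} (hB : 0 < B) {l : List ℕ} (hl : ∀ a ∈ l, 1 ≤ a) {x : ℝ}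
    (hx : x ∈ Set.Ioo (0 : ℝ) 1) :
    Real.exp (birkhoffSum gaussMap (potential B s) l.length (cfPoint l x)) =
      B ^ (-(l.length * s ^ 2)) * cfProd l x ^ (-2 * s) := by
  induction l with
  | nil => simp [cfProd]
  | cons a l ih =>
    have hl' : ∀ b ∈ l, 1 ≤ b := fun b hb => hl b (by simp [hb])
    have h1 : (1 : ℝ) ≤ a := by exact_mod_cast hl a (by simp)
    have hy := cfPoint_mem_Ioo hl' hx
    have h0 : 0 < (a : ℝ) + cfPoint l x := by linarith [hy.1]
    rw [List.length_cons, birkhoffSum_succ', cfPoint_cons, gaussMap_one_div ⟨hy.1.le, hy.2⟩,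
      Real.exp_add, ih hl', potential, (hasDerivAt_gaussMap hy).deriv, cfProd,
      Real.mul_rpow h0.le (cfProd_pos hl' hx.1.le).le, abs_neg, abs_of_pos (by positivity),
      Real.log_pow, Real.rpow_def_of_pos h0, Real.rpow_def_of_pos hB, Real.rpow_def_of_pos hB]
    push_cast
    rw [← mul_assoc, ← mul_assoc, ← Real.exp_add, ← Real.exp_add]
    congr 2
    ring

/-! ### Comparison of the partition sums with sums of powers of denominators. -/

/-- The sum `∑ qₙ(a₁, …, aₙ)^{-2s}` over the words of length `n` in the alphabet `A`. -/
def cfSum (A : Set ℕ) (n : ℕ) (s : ℝ) : ENNReal :=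
  ∑' a : Fin n → A, ENNReal.ofReal ((cfDenom (List.ofFn fun i => (a i : ℕ)) : ℝ) ^ (-2 * s))

lemma one_le_of_mem_ofFn {A : Set ℕ} (hA : ∀ a ∈ A, 1 ≤ a) {n : ℕ} (a : Fin n → A) :
    ∀ b ∈ List.ofFn fun i => (a i : ℕ), 1 ≤ b := by
  intro b hb
  obtain ⟨i, rfl⟩ := (List.mem_ofFn' _ _).1 hb
  exact hA _ (a i).2

lemma one_le_cfDenom_ofFn {A : Set ℕ} (hA : ∀ a ∈ A, 1 ≤ a) {n : ℕ} (a : Fin n → A) :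
    (1 : ℝ) ≤ cfDenom (List.ofFn fun i => (a i : ℕ)) := by
  exact_mod_cast cfDenom_pos (one_le_of_mem_ofFn hA a)

lemma g_eq {A : Set ℕ} (hA : ∀ a ∈ A, 1 ≤ a) {B : ℝ} (hB : 0 < B) (n : ℕ) (s : ℝ) :
    g A B n s = ENNReal.ofReal (B ^ (-(n * s ^ 2))) * cfSum A n s := by
  rw [g, cfSum, ← ENNReal.tsum_mul_left]
  congr 1
  ext a
  have hq := one_le_cfDenom_ofFn hA a
  set q : ℝ := (cfDenom (List.ofFn fun i => (a i : ℕ)) : ℝ)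
  rw [← ENNReal.ofReal_mul (by positivity), one_div, Real.inv_rpow (by positivity),
    Real.mul_rpow (by positivity) (by positivity), mul_inv, ← Real.rpow_mul hB.le,
    ← Real.rpow_neg hB.le, ← Real.rpow_natCast q 2, ← Real.rpow_mul (by positivity),
    ← Real.rpow_neg (by positivity)]
  congr 3
  · ring
  · push_cast; ring

lemma cfProd_rpow_le {l : List ℕ} (hl : ∀ a ∈ l, 1 ≤ a) {x s : ℝ} (hx : 0 ≤ x) (hs : 0 ≤ s) :
    cfProd l x ^ (-2 * s) ≤ (cfDenom l : ℝ) ^ (-2 * s) := by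
  have hq : (1 : ℝ) ≤ cfDenom l := by exact_mod_cast cfDenom_pos hl
  refine Real.rpow_le_rpow_of_nonpos (by linarith) ?_ (by linarith)
  rw [cfProd_eq hl hx]
  exact le_add_of_nonneg_right (by positivity)

/-- Bounded distortion: `qₙ + x q_{n-1} ≤ 2 qₙ`, with a constant independent of the word. -/
lemma le_cfProd_rpow {l : List ℕ} (hl : ∀ a ∈ l, 1 ≤ a) {x s : ℝ} (hx : x ∈ Set.Ioo (0 : ℝ) 1)
    (hs : 0 ≤ s) :
    (4 : ℝ) ^ (-s) * (cfDenom l : ℝ) ^ (-2 * s) ≤ cfProd l x ^ (-2 * s) := by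
  have hq : (1 : ℝ) ≤ cfDenom l := by exact_mod_cast cfDenom_pos hl
  have h1 : ((cfState l (0, 1)).1 : ℝ) ≤ cfDenom l := by
    exact_mod_cast cfState_fst_le hl (by simp)
  have h4 : (4 : ℝ) ^ (-s) = 2 ^ (-2 * s) := by
    rw [show (4 : ℝ) = 2 ^ (2 : ℝ) by norm_num, ← Real.rpow_mul (by norm_num)]
    congr 1
    ring
  rw [h4, ← Real.mul_rpow (by norm_num) (by linarith)]
  refine Real.rpow_le_rpow_of_nonpos (cfProd_pos hl hx.1.le) ?_ (by linarith)
  rw [cfProd_eq hl hx.1.le]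
  have h2 : x * ((cfState l (0, 1)).1 : ℝ) ≤ 1 * cfDenom l :=
    mul_le_mul hx.2.le h1 (by positivity) zero_le_one
  linarith

lemma exp_birkhoffSum_ofFn {A : Set ℕ} (hA : ∀ a ∈ A, 1 ≤ a) {B s : ℝ} (hB : 0 < B) {n : ℕ}
    (a : Fin n → A) {x : ℝ} (hx : x ∈ Set.Ioo (0 : ℝ) 1) :
    Real.exp (birkhoffSum gaussMap (potential B s) n (cfPoint (List.ofFn fun i => (a i : ℕ)) x)) =
      B ^ (-(n * s ^ 2)) * cfProd (List.ofFn fun i => (a i : ℕ)) x ^ (-2 * s) := by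
  have := exp_birkhoffSum (s := s) hB (one_le_of_mem_ofFn hA a) hx
  simpa only [List.length_ofFn] using this

lemma partitionSum_le {A : Set ℕ} (hA : ∀ a ∈ A, 1 ≤ a) {B s : ℝ} (hB : 0 < B) (hs : 0 ≤ s)
    (n : ℕ) :
    partitionSum A (potential B s) n ≤ ENNReal.ofReal (B ^ (-(n * s ^ 2))) * cfSum A n s := by
  rw [partitionSum, cfSum, ← ENNReal.tsum_mul_left]
  refine ENNReal.tsum_le_tsum fun a => iSup₂_le fun x hx => ?_
  have hx' := digitSet_subset hA hx
  rw [exp_birkhoffSum_ofFn hA hB a hx', ENNReal.ofReal_mul (by positivity)]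
  refine mul_le_mul_right (ENNReal.ofReal_le_ofReal ?_) _
  exact cfProd_rpow_le (one_le_of_mem_ofFn hA a) hx'.1.le hs

/-- By bounded distortion a single point of `Y_A` already gives a lower bound for every supremum. -/
lemma le_partitionSum {A : Set ℕ} (hA : ∀ a ∈ A, 1 ≤ a) (h1 : 1 ∈ A) {B s : ℝ} (hB : 0 < B)
    (hs : 0 ≤ s) (n : ℕ) :
    ENNReal.ofReal (4 ^ (-s)) * (ENNReal.ofReal (B ^ (-(n * s ^ 2))) * cfSum A n s) ≤
      partitionSum A (potential B s) n := by
  obtain ⟨x, hx⟩ := digitSet_nonempty h1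
  have hx' := digitSet_subset hA hx
  rw [partitionSum, cfSum, ← ENNReal.tsum_mul_left, ← ENNReal.tsum_mul_left]
  refine ENNReal.tsum_le_tsum fun a => le_iSup₂_of_le x hx ?_
  rw [exp_birkhoffSum_ofFn hA hB a hx', ENNReal.ofReal_mul (by positivity), mul_left_comm,
    ← ENNReal.ofReal_mul (by positivity)]
  gcongr
  exact le_cfProd_rpow (one_le_of_mem_ofFn hA a) hx' hs

lemma cfSum_add (A : Set ℕ) (m n : ℕ) (s : ℝ) :
    cfSum A (m + n) s = ∑' a : Fin m → A, ∑' b : Fin n → A, ENNReal.ofReal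
      ((cfDenom ((List.ofFn fun i => (a i : ℕ)) ++ List.ofFn fun i => (b i : ℕ)) : ℝ)
        ^ (-2 * s)) := by
  rw [cfSum, ← (Fin.appendEquiv m n).tsum_eq,
    ENNReal.summable.tsum_prod' fun _ => ENNReal.summable]
  refine tsum_congr fun a => tsum_congr fun b => ?_
  rw [← List.ofFn_fin_append]
  congr 5
  ext i
  refine Fin.addCases (fun i => ?_) (fun i => ?_) i <;> simp [Fin.appendEquiv]

lemma cfSum_mul_eq (A : Set ℕ) (m n : ℕ) (s : ℝ) :
    cfSum A m s * cfSum A n s = ∑' a : Fin m → A, ∑' b : Fin n → A, ENNReal.ofReal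
      (((cfDenom (List.ofFn fun i => (a i : ℕ)) : ℝ) * cfDenom (List.ofFn fun i => (b i : ℕ)))
        ^ (-2 * s)) := by
  rw [cfSum, ← ENNReal.tsum_mul_right]
  refine tsum_congr fun a => ?_
  rw [cfSum, ← ENNReal.tsum_mul_left]
  refine tsum_congr fun b => ?_
  rw [Real.mul_rpow (by positivity) (by positivity), ENNReal.ofReal_mul (by positivity)]

lemma cfSum_add_le {A : Set ℕ} (hA : ∀ a ∈ A, 1 ≤ a) {s : ℝ} (hs : 0 ≤ s) (m n : ℕ) :
    cfSum A (m + n) s ≤ cfSum A m s * cfSum A n s := by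
  rw [cfSum_add, cfSum_mul_eq]
  refine ENNReal.tsum_le_tsum fun a => ENNReal.tsum_le_tsum fun b => ?_
  have := one_le_cfDenom_ofFn hA a
  have := one_le_cfDenom_ofFn hA b
  exact ENNReal.ofReal_le_ofReal (Real.rpow_le_rpow_of_nonpos (by positivity)
    (cfDenom_mul_le (one_le_of_mem_ofFn hA b)) (by linarith))

lemma cfSum_mul_le {A : Set ℕ} (hA : ∀ a ∈ A, 1 ≤ a) {s : ℝ} (hs : 0 ≤ s) (m n : ℕ) :
    cfSum A m s * cfSum A n s ≤ ENNReal.ofReal (4 ^ s) * cfSum A (m + n) s := by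
  rw [cfSum_add, cfSum_mul_eq, ← ENNReal.tsum_mul_left]
  refine ENNReal.tsum_le_tsum fun a => ?_
  rw [← ENNReal.tsum_mul_left]
  refine ENNReal.tsum_le_tsum fun b => ?_
  have hla := one_le_of_mem_ofFn hA a
  have hlb := one_le_of_mem_ofFn hA b
  have h1 := one_le_cfDenom_ofFn hA a
  have h2 := one_le_cfDenom_ofFn hA b
  have h3 := cfDenom_mul_le (l₁ := List.ofFn fun i => (a i : ℕ)) hlb
  have h4 := cfDenom_append_le hla hlb
  set q₁ : ℝ := (cfDenom (List.ofFn fun i => (a i : ℕ)) : ℝ)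
  set q₂ : ℝ := (cfDenom (List.ofFn fun i => (b i : ℕ)) : ℝ)
  set q : ℝ := (cfDenom ((List.ofFn fun i => (a i : ℕ)) ++ List.ofFn fun i => (b i : ℕ)) : ℝ)
  have h5 : 0 < q₁ * q₂ := by positivity
  -- Written this way, the constant moves inside the power and cancels the 2 of `cfDenom_append_le`.
  have h6 : (4 : ℝ) ^ s = 2⁻¹ ^ (-2 * s) := by
    rw [Real.inv_rpow (by norm_num), ← Real.rpow_neg (by norm_num),
      show (4 : ℝ) = 2 ^ (2 : ℝ) by norm_num, ← Real.rpow_mul (by norm_num)]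
    congr 1
    ring
  rw [← ENNReal.ofReal_mul (by positivity), h6, ← Real.mul_rpow (by norm_num) (by linarith)]
  exact ENNReal.ofReal_le_ofReal (Real.rpow_le_rpow_of_nonpos (by linarith) (by linarith)
    (by linarith))

/-- Uses `qₙ² ≥ 2^n / 2`; after taking `(1/n) log` it bounds the slope of the pressure by `-log 2`.
-/
lemma cfSum_add_right_le {A : Set ℕ} (hA : ∀ a ∈ A, 1 ≤ a) (n : ℕ) (s : ℝ) {d : ℝ} (hd : 0 ≤ d) :
    cfSum A n (s + d) ≤ ENNReal.ofReal ((2 ^ n / 2 : ℝ) ^ (-d)) * cfSum A n s := by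
  rw [cfSum, cfSum, ← ENNReal.tsum_mul_left]
  refine ENNReal.tsum_le_tsum fun a => ?_
  have hq := one_le_cfDenom_ofFn hA a
  have hq2 : (2 : ℝ) ^ n ≤ 2 * (cfDenom (List.ofFn fun i => (a i : ℕ)) : ℝ) ^ 2 := by
    have := two_pow_le_cfDenom_sq (one_le_of_mem_ofFn hA a)
    rw [List.length_ofFn] at this
    exact_mod_cast this
  set q : ℝ := (cfDenom (List.ofFn fun i => (a i : ℕ)) : ℝ)
  rw [← ENNReal.ofReal_mul (by positivity)]
  refine ENNReal.ofReal_le_ofReal ?_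
  rw [show -2 * (s + d) = 2 * -d + -2 * s by ring, Real.rpow_add (by positivity),
    Real.rpow_mul (by positivity), Real.rpow_two]
  exact mul_le_mul_of_nonneg_right
    (Real.rpow_le_rpow_of_nonpos (by positivity) (by linarith) (by linarith)) (by positivity)

lemma cfSum_anti {A : Set ℕ} (hA : ∀ a ∈ A, 1 ≤ a) (n : ℕ) {s t : ℝ} (h : s ≤ t) :
    cfSum A n t ≤ cfSum A n s := by
  refine ENNReal.tsum_le_tsum fun a => ENNReal.ofReal_le_ofReal ?_
  exact Real.rpow_le_rpow_of_exponent_le (one_le_cfDenom_ofFn hA a) (by linarith)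

lemma cfSum_mono {A A' : Set ℕ} (h : A ⊆ A') (n : ℕ) (s : ℝ) : cfSum A n s ≤ cfSum A' n s := by
  have hinj : Function.Injective fun (a : Fin n → A) (i : Fin n) => Set.inclusion h (a i) :=
    fun a b hab => funext fun i => Set.inclusion_injective h (congrFun hab i)
  exact ENNReal.tsum_comp_le_tsum_of_injective hinj fun a : Fin n → A' =>
    ENNReal.ofReal ((cfDenom (List.ofFn fun i => (a i : ℕ)) : ℝ) ^ (-2 * s))

lemma cfSum_ne_zero {A : Set ℕ} (hA : ∀ a ∈ A, 1 ≤ a) (h1 : 1 ∈ A) (n : ℕ) (s : ℝ) :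
    cfSum A n s ≠ 0 := by
  rw [cfSum, Ne, ENNReal.tsum_eq_zero]
  push Not
  refine ⟨fun _ => ⟨1, h1⟩, ?_⟩
  have := one_le_cfDenom_ofFn hA fun _ : Fin n => ⟨1, h1⟩
  rw [Ne, ENNReal.ofReal_eq_zero, not_le]
  positivity

lemma cfSum_one (A : Set ℕ) (s : ℝ) :
    cfSum A 1 s = ∑' a : A, ENNReal.ofReal ((a : ℝ) ^ (-2 * s)) := by
  rw [cfSum, ← (Equiv.funUnique (Fin 1) A).symm.tsum_eq]
  refine tsum_congr fun a => ?_
  simp [cfDenom]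

/-! ### The alphabets `{1, …, M}` and `{1, 2, …}`. -/

lemma one_le_of_mem_finAlphabet {M : ℕ} : ∀ a ∈ finAlphabet M, 1 ≤ a := fun _ h => h.1

lemma one_le_of_mem_fullAlphabet : ∀ a ∈ fullAlphabet, 1 ≤ a := fun _ h => h

lemma one_mem_finAlphabet {M : ℕ} (hM : 1 ≤ M) : 1 ∈ finAlphabet M := ⟨le_rfl, hM⟩

lemma one_mem_fullAlphabet : 1 ∈ fullAlphabet := Set.mem_Ici.2 le_rfl

lemma finAlphabet_subset (M : ℕ) : finAlphabet M ⊆ fullAlphabet := fun _ h => h.1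

lemma tsum_fullAlphabet (f : ℕ → ENNReal) :
    ∑' a : fullAlphabet, f a = ∑' n : ℕ, f (n + 1) := by
  let e : ℕ ≃ fullAlphabet :=
    { toFun := fun n => ⟨n + 1, Nat.le_add_left 1 n⟩
      invFun := fun a => a - 1
      left_inv := fun n => by simp
      right_inv := fun a => Subtype.ext (Nat.sub_add_cancel a.2) }
  exact (e.tsum_eq fun a : fullAlphabet => f a).symm

lemma cfSum_fullAlphabet_one_eq_top {s : ℝ} (hs : s ≤ 1 / 2) : cfSum fullAlphabet 1 s = ⊤ := by
  rw [cfSum_one, tsum_fullAlphabet fun a => ENNReal.ofReal ((a : ℝ) ^ (-2 * s))]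
  by_contra hne
  have h := ENNReal.summable_toReal hne
  have h2 : Summable fun n : ℕ => ((n : ℝ)) ^ (-2 * s) := by
    rw [← summable_nat_add_iff 1]
    refine h.congr fun n => ?_
    rw [ENNReal.toReal_ofReal (by positivity)]
  rw [Real.summable_nat_rpow] at h2
  linarith

/-! ### The sum of the lengths of the cylinders -/

lemma tsum_one_div_mul_shift {u v : ℝ} (hu : 0 ≤ u) (hv : 0 < v) :
    ∑' n : ℕ, ENNReal.ofReal (1 / (((n + 1) * v + u) * ((n + 1) * v + u + v))) =
      ENNReal.ofReal (1 / (v * (v + u))) := by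
  -- Partial fractions make the series telescope.
  have hf : ∀ n : ℕ, 1 / (((n + 1) * v + u) * ((n + 1) * v + u + v)) =
      1 / (v * ((n + 1) * v + u)) - 1 / (v * (((n + 1 : ℕ) + 1) * v + u)) := by
    intro n
    have h1 : 0 < (n + 1) * v + u := by positivity
    push_cast
    field_simp
    ring
  have hlim : Tendsto (fun n : ℕ => 1 / (v * (((n : ℝ) + 1) * v + u))) atTop (𝓝 0) := by
    refine Tendsto.div_atTop tendsto_const_nhds (Tendsto.const_mul_atTop hv ?_)
    exact tendsto_atTop_add_const_right _ _ (Tendsto.atTop_mul_const hv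
      (tendsto_atTop_add_const_right _ _ tendsto_natCast_atTop_atTop))
  have hsum : HasSum (fun n : ℕ => 1 / (((n + 1) * v + u) * ((n + 1) * v + u + v)))
      (1 / (v * (v + u))) := by
    rw [hasSum_iff_tendsto_nat_of_nonneg (fun n => by positivity)]
    have h2 : ∀ N : ℕ, ∑ n ∈ Finset.range N, 1 / (((n + 1) * v + u) * ((n + 1) * v + u + v)) =
        1 / (v * (v + u)) - 1 / (v * (((N : ℝ) + 1) * v + u)) := by
      intro N
      rw [Finset.sum_congr rfl fun n _ => hf n,
        Finset.sum_range_sub' (fun n : ℕ => 1 / (v * (((n : ℝ) + 1) * v + u)))]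
      simp
    simp_rw [h2]
    simpa using tendsto_const_nhds.sub hlim
  rw [← ENNReal.ofReal_tsum_of_nonneg (fun n => by positivity) hsum.summable, hsum.tsum_eq]

/-- For `p = (0, 1)` the terms are the lengths of the cylinders of order `n`, which fill the unit
interval. The induction splits off the first digit, which only changes the initial pair, and sums
over it by telescoping. -/
lemma tsum_cylinder_length (n : ℕ) (p : ℕ × ℕ) (hp : 1 ≤ p.2) :
    ∑' a : Fin n → fullAlphabet, ENNReal.ofReal
      (1 / (((cfState (List.ofFn fun i => (a i : ℕ)) p).2 : ℝ) *
        ((cfState (List.ofFn fun i => (a i : ℕ)) p).2 +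
          (cfState (List.ofFn fun i => (a i : ℕ)) p).1))) =
      ENNReal.ofReal (1 / ((p.2 : ℝ) * (p.2 + p.1))) := by
  induction n generalizing p with
  | zero => simp [cfState_nil]
  | succ n ih =>
    rw [← (Fin.consEquiv fun _ => (fullAlphabet : Type)).tsum_eq,
    ENNReal.summable.tsum_prod' fun _ => ENNReal.summable]
    have h : ∀ b : fullAlphabet, ∑' a : Fin n → fullAlphabet, ENNReal.ofReal
        (1 / (((cfState (List.ofFn fun i =>
            ((Fin.consEquiv (fun _ => (fullAlphabet : Type)) (b, a)) i : ℕ)) p).2 : ℝ) *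
          ((cfState (List.ofFn fun i =>
            ((Fin.consEquiv (fun _ => (fullAlphabet : Type)) (b, a)) i : ℕ)) p).2 +
          (cfState (List.ofFn fun i =>
            ((Fin.consEquiv (fun _ => (fullAlphabet : Type)) (b, a)) i : ℕ)) p).1))) =
        ENNReal.ofReal (1 / (((b : ℕ) * (p.2 : ℝ) + p.1) * ((b : ℕ) * (p.2 : ℝ) + p.1 + p.2))) := by
      intro b
      have hb : 1 ≤ (b : ℕ) := b.2
      have := ih (p.2, (b : ℕ) * p.2 + p.1) (by dsimp only; nlinarith)
      simp only [Fin.consEquiv, Equiv.coe_fn_mk, List.ofFn_succ, Fin.cons_zero, Fin.cons_succ,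
        cfState_cons]
      rw [this]
      push_cast
      rfl
    rw [tsum_congr h, tsum_fullAlphabet fun b =>
      ENNReal.ofReal (1 / ((b * (p.2 : ℝ) + p.1) * (b * (p.2 : ℝ) + p.1 + p.2)))]
    push_cast
    exact tsum_one_div_mul_shift (by positivity) (by positivity)

/-- As `q_{n-1} ≤ qₙ`, a cylinder length lies between `1 / (2 qₙ²)` and `1 / qₙ²`, and the lengths
sum to 1. -/
lemma cfSum_fullAlphabet_bounds (n : ℕ) :
    1 ≤ cfSum fullAlphabet n 1 ∧ cfSum fullAlphabet n 1 ≤ 2 := by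
  have h := tsum_cylinder_length n (0, 1) le_rfl
  have hR : ENNReal.ofReal (1 / ((((0, 1) : ℕ × ℕ).2 : ℝ) *
      ((((0, 1) : ℕ × ℕ).2 : ℝ) + ((0, 1) : ℕ × ℕ).1))) = 1 := by simp
  rw [hR] at h
  have hpow : ∀ a : Fin n → fullAlphabet,
      (cfDenom (List.ofFn fun i => (a i : ℕ)) : ℝ) ^ (-2 * 1 : ℝ) =
        1 / (cfDenom (List.ofFn fun i => (a i : ℕ)) : ℝ) ^ 2 := by
    intro a
    rw [mul_one, Real.rpow_neg (by positivity), Real.rpow_two, one_div]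
  constructor
  · rw [← h, cfSum]
    refine ENNReal.tsum_le_tsum fun a => ENNReal.ofReal_le_ofReal ?_
    have hq := one_le_cfDenom_ofFn one_le_of_mem_fullAlphabet a
    rw [hpow, ← cfDenom_eq]
    refine one_div_le_one_div_of_le (by positivity) ?_
    rw [sq]
    gcongr
    exact le_add_of_nonneg_right (by positivity)
  · rw [← mul_one 2, ← h, cfSum, ← ENNReal.tsum_mul_left]
    refine ENNReal.tsum_le_tsum fun a => ?_
    have hq := one_le_cfDenom_ofFn one_le_of_mem_fullAlphabet a
    have hl := one_le_of_mem_ofFn one_le_of_mem_fullAlphabet a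
    have h1 : ((cfState (List.ofFn fun i => (a i : ℕ)) (0, 1)).1 : ℝ) ≤
        cfDenom (List.ofFn fun i => (a i : ℕ)) := by
      exact_mod_cast cfState_fst_le hl (by simp)
    rw [← ENNReal.ofReal_ofNat 2, ← ENNReal.ofReal_mul (by norm_num), hpow, ← cfDenom_eq]
    refine ENNReal.ofReal_le_ofReal ?_
    rw [mul_one_div, div_le_div_iff₀ (by positivity) (by positivity)]
    nlinarith

/-- A sum in `[0, ∞]` is the supremum of its finite partial sums, and finitely many words involve
only finitely many digits. This also covers an infinite limit. -/
lemma tendsto_cfSum_finAlphabet (n : ℕ) (s : ℝ) :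
    Tendsto (fun M => cfSum (finAlphabet M) n s) atTop (𝓝 (cfSum fullAlphabet n s)) := by
  classical
  refine tendsto_order.2 ⟨fun c hc => ?_, fun c hc => Eventually.of_forall fun M =>
    (cfSum_mono (finAlphabet_subset M) n s).trans_lt hc⟩
  rw [cfSum, ENNReal.tsum_eq_iSup_sum, lt_iSup_iff] at hc
  obtain ⟨S, hS⟩ := hc
  filter_upwards [eventually_ge_atTop (S.sup fun a => Finset.univ.sup fun i => (a i : ℕ))]
    with M hM
  refine hS.trans_le ?_
  have hmem : ∀ a ∈ S, ∀ i, (a i : ℕ) ∈ finAlphabet M := fun a ha i =>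
    ⟨(a i).2, (Finset.le_sup (f := fun i => (a i : ℕ)) (Finset.mem_univ i)).trans
      ((Finset.le_sup (f := fun a : Fin n → fullAlphabet =>
        Finset.univ.sup fun i => (a i : ℕ)) ha).trans hM)⟩
  have hinj : Function.Injective fun (a : S) (i : Fin n) =>
      (⟨(a.1 i : ℕ), hmem a.1 a.2 i⟩ : finAlphabet M) := fun a b hab =>
    Subtype.ext (funext fun i => Subtype.ext
      (congrArg (fun c : Fin n → finAlphabet M => (c i : ℕ)) hab))
  rw [← Finset.tsum_subtype]
  exact ENNReal.tsum_comp_le_tsum_of_injective hinj fun a : Fin n → finAlphabet M =>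
    ENNReal.ofReal ((cfDenom (List.ofFn fun i => (a i : ℕ)) : ℝ) ^ (-2 * s))

/-! ### Almost multiplicative sequences -/

/-- Both `log u` and `log K - log u` are subadditive. Fekete's lemma for the first gives the limit
and bounds it above by each term; for the second it gives the lower bound with error `log K / n`. -/
lemma exists_tendsto_log_div {u : ℕ → ENNReal} {K : ℝ} (hK : 0 < K) (h0 : ∀ n, u n ≠ 0)
    (hsub : ∀ m n, u (m + n) ≤ u m * u n)
    (hsup : ∀ m n, u m * u n ≤ ENNReal.ofReal K * u (m + n)) :
    ∃ P : EReal, Tendsto (fun n : ℕ => ENNReal.log (u n) / (n : EReal)) atTop (𝓝 P) ∧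
      ∀ n : ℕ, 1 ≤ n → P ≤ ENNReal.log (u n) / (n : EReal) ∧
        ENNReal.log (u n) / (n : EReal) + ((-(Real.log K / n) : ℝ) : EReal) ≤ P := by
  have hpos : ∀ n : ℕ, 1 ≤ n → (0 : EReal) < n := fun n hn => by exact_mod_cast hn
  by_cases h1 : u 1 = ⊤
  -- If `u 1 = ∞`, then `u 1 * u k ≤ K * u (1 + k)` with `u k ≠ 0` makes all later terms infinite.
  · have htop : ∀ n : ℕ, 1 ≤ n → ENNReal.log (u n) / (n : EReal) = ⊤ := by
      intro n hn
      obtain ⟨k, rfl⟩ := Nat.exists_eq_add_of_le hn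
      have := hsup 1 k
      rw [h1, ENNReal.top_mul (h0 k), top_le_iff, ENNReal.mul_eq_top] at this
      have hu : u (1 + k) = ⊤ := by simpa [hK] using this
      rw [hu, ENNReal.log_top, EReal.top_div_of_pos_ne_top (hpos _ hn) (EReal.natCast_ne_top _)]
    refine ⟨⊤, tendsto_const_nhds.congr' ?_, fun n hn => ⟨(htop n hn).ge, le_top⟩⟩
    filter_upwards [eventually_ge_atTop 1] with n hn
    exact (htop n hn).symm
  · have hone : u 0 ≠ ⊤ := by
      intro h
      have := hsup 0 1
      rw [h, ENNReal.top_mul (h0 1), top_le_iff, ENNReal.mul_eq_top] at this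
      simp [h1] at this
    have hfin : ∀ n, u n ≠ ⊤ := by
      intro n
      induction n with
      | zero => exact hone
      | succ n ih => exact ne_top_of_le_ne_top (ENNReal.mul_ne_top ih h1) (hsub n 1)
    have hupos : ∀ n, 0 < (u n).toReal := fun n => ENNReal.toReal_pos (h0 n) (hfin n)
    set r : ℕ → ℝ := fun n => Real.log (u n).toReal with hr
    have hlog : ∀ n : ℕ, ENNReal.log (u n) / (n : EReal) = ((r n / n : ℝ) : EReal) := by
      intro n
      rw [ENNReal.log_pos_real (h0 n) (hfin n), EReal.coe_div, EReal.coe_natCast]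
    have hs1 : Subadditive r := by
      intro m n
      rw [hr, ← Real.log_mul (hupos m).ne' (hupos n).ne', ← ENNReal.toReal_mul]
      exact Real.log_le_log (hupos _)
        (ENNReal.toReal_mono (ENNReal.mul_ne_top (hfin m) (hfin n)) (hsub m n))
    have hs2 : ∀ m n, r m + r n ≤ Real.log K + r (m + n) := by
      intro m n
      rw [hr, ← Real.log_mul (hupos m).ne' (hupos n).ne', ← ENNReal.toReal_mul,
        ← Real.log_mul hK.ne' (hupos _).ne']
      have := ENNReal.toReal_mono (ENNReal.mul_ne_top ENNReal.ofReal_ne_top (hfin _)) (hsup m n)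
      rw [ENNReal.toReal_mul (a := ENNReal.ofReal K), ENNReal.toReal_ofReal hK.le] at this
      refine Real.log_le_log ?_ this
      rw [ENNReal.toReal_mul]
      exact mul_pos (hupos m) (hupos n)
    have hs3 : Subadditive fun n => Real.log K - r n := fun m n => by
      dsimp only
      linarith [hs2 m n]
    -- Crude linear bounds, needed only because Fekete's lemma asks for quotients bounded below.
    have hb1 : ∀ n : ℕ, r 0 - |r 1 - Real.log K| * n - |Real.log K| ≤ r n := by
      intro n
      induction n with
      | zero => simp
      | succ n ih =>
        have := hs2 n 1
        have h3 := neg_abs_le (r 1 - Real.log K)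
        push_cast
        linarith
    have hb2 : ∀ n : ℕ, r n ≤ |r 0| + |r 1| * n := by
      intro n
      induction n with
      | zero => simpa using le_abs_self (r 0)
      | succ n ih =>
        have := hs1 n 1
        have h3 := le_abs_self (r 1)
        push_cast
        linarith
    have hbdd : ∀ (v : ℕ → ℝ) (a b : ℝ), (∀ n : ℕ, -(a + b * n) ≤ v n) → 0 ≤ a → 0 ≤ b →
        BddBelow (Set.range fun n : ℕ => v n / n) := by
      intro v a b hv ha hb
      refine ⟨-(a + b), ?_⟩
      rintro _ ⟨n, rfl⟩
      dsimp only
      rcases Nat.eq_zero_or_pos n with rfl | hn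
      · simp only [Nat.cast_zero, div_zero]
        linarith
      · have hn' : (1 : ℝ) ≤ n := by exact_mod_cast hn
        rw [le_div_iff₀ (by linarith)]
        have := hv n
        nlinarith
    have hd1 := hbdd r (|r 0| + |Real.log K|) (|r 1 - Real.log K|)
      (fun n => by linarith [hb1 n, neg_abs_le (r 0)]) (by positivity) (by positivity)
    have hd2 := hbdd (fun n => Real.log K - r n) (|Real.log K| + |r 0|) (|r 1|)
      (fun n => by linarith [hb2 n, neg_abs_le (Real.log K)]) (by positivity) (by positivity)
    have ht1 := hs1.tendsto_lim hd1
    have ht2 := hs3.tendsto_lim hd2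
    have hlim : hs3.lim = -hs1.lim := by
      refine tendsto_nhds_unique ht2 ?_
      have h3 : Tendsto (fun n : ℕ => Real.log K / n) atTop (𝓝 0) :=
        tendsto_const_div_atTop_nhds_zero_nat _
      simpa [sub_div] using h3.sub ht1
    refine ⟨(hs1.lim : ℝ), ?_, fun n hn => ⟨?_, ?_⟩⟩
    · simp_rw [hlog]
      exact EReal.tendsto_coe.2 ht1
    · rw [hlog, EReal.coe_le_coe_iff]
      exact hs1.lim_le_div hd1 (by omega)
    · rw [hlog, ← EReal.coe_add, EReal.coe_le_coe_iff]
      have := hs3.lim_le_div hd2 (n := n) (by omega)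
      rw [hlim, sub_div] at this
      linarith

/-! ### The point where a decreasing function crosses `s² b` -/

/-- The infimum of the `s ≥ 0` with `p s ≤ s² b`. -/
def crossing (p : ℝ → EReal) (b : ℝ) : ℝ := sInf {s | 0 ≤ s ∧ p s ≤ ((s ^ 2 * b : ℝ) : EReal)}

lemma crossing_nonneg (p : ℝ → EReal) (b : ℝ) : 0 ≤ crossing p b :=
  Real.sInf_nonneg fun _ hs => hs.1

lemma crossing_le {p : ℝ → EReal} {b s : ℝ} (hs : 0 ≤ s) (h : p s ≤ ((s ^ 2 * b : ℝ) : EReal)) :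
    crossing p b ≤ s :=
  csInf_le ⟨0, fun _ hx => hx.1⟩ ⟨hs, h⟩

lemma lt_of_lt_crossing {p : ℝ → EReal} {b s : ℝ} (hs : 0 ≤ s) (h : s < crossing p b) :
    ((s ^ 2 * b : ℝ) : EReal) < p s := by
  by_contra hc
  exact (crossing_le hs (not_lt.1 hc)).not_gt h

/-- Strictness comes from the parabola, which increases strictly when `b > 0`; `p` may be constant.
-/
lemma lt_of_crossing_lt {p : ℝ → EReal} (hp : AntitoneOn p (Set.Ici 0)) {b s : ℝ} (hb : 0 < b)
    (hne : {s | 0 ≤ s ∧ p s ≤ ((s ^ 2 * b : ℝ) : EReal)}.Nonempty) (h : crossing p b < s) :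
    p s < ((s ^ 2 * b : ℝ) : EReal) := by
  obtain ⟨r, ⟨hr0, hr⟩, hrs⟩ := exists_lt_of_csInf_lt hne h
  refine (hp hr0 (hr0.trans hrs.le : (0 : ℝ) ≤ s) hrs.le).trans_lt (hr.trans_lt ?_)
  rw [EReal.coe_lt_coe_iff]
  gcongr

lemma le_crossing {p : ℝ → EReal} (hp : AntitoneOn p (Set.Ici 0)) {b s : ℝ} (hb : 0 ≤ b)
    (hne : {s | 0 ≤ s ∧ p s ≤ ((s ^ 2 * b : ℝ) : EReal)}.Nonempty) (hs : 0 ≤ s)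
    (h : ((s ^ 2 * b : ℝ) : EReal) < p s) : s ≤ crossing p b := by
  refine le_csInf hne fun r ⟨hr0, hr⟩ => ?_
  by_contra! hc
  refine ((h.trans_le (hp hr0 hs hc.le)).trans_le hr).not_ge ?_
  rw [EReal.coe_le_coe_iff]
  gcongr

lemma tendsto_crossing {ι : Type*} {l : Filter ι} {p : ι → ℝ → EReal} {b : ι → ℝ} {t : ℝ}
    (hp : ∀ᶠ i in l, AntitoneOn (p i) (Set.Ici 0)) (hb : ∀ᶠ i in l, 0 ≤ b i) (ht : 0 ≤ t)
    (hlow : ∀ s, 0 ≤ s → s < t → ∀ᶠ i in l, ((s ^ 2 * b i : ℝ) : EReal) < p i s)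
    (hup : ∀ s, t < s → ∀ᶠ i in l, p i s ≤ ((s ^ 2 * b i : ℝ) : EReal)) :
    Tendsto (fun i => crossing (p i) (b i)) l (𝓝 t) := by
  refine tendsto_order.2 ⟨fun c hc => ?_, fun c hc => ?_⟩
  · rcases lt_or_ge c 0 with h0 | h0
    · exact Eventually.of_forall fun i => h0.trans_le (crossing_nonneg _ _)
    · obtain ⟨s, hcs, hst⟩ := exists_between hc
      -- The point `t + 1` keeps the set defining the crossing non-empty; an empty set would have
      -- infimum 0 by convention.
      filter_upwards [hp, hb, hlow s (h0.trans hcs.le) hst, hup (t + 1) (by linarith)]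
        with i h1 h2 h3 h4
      exact hcs.trans_le
        (le_crossing h1 h2 ⟨t + 1, by positivity, h4⟩ (h0.trans hcs.le) h3)
  · obtain ⟨s, hts, hsc⟩ := exists_between hc
    filter_upwards [hup s hts] with i h1
    exact (crossing_le (ht.trans hts.le) h1).trans_lt hsc

/-- On either side of the limiting crossing the inequality is strict, hence survives pointwise
convergence. -/
lemma tendsto_crossing_of_tendsto {ι : Type*} {l : Filter ι} {p : ι → ℝ → EReal} {b : ι → ℝ}
    {p₀ : ℝ → EReal} {b₀ : ℝ} (hp : ∀ᶠ i in l, AntitoneOn (p i) (Set.Ici 0))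
    (hp₀ : AntitoneOn p₀ (Set.Ici 0)) (hb₀ : 0 < b₀)
    (hne : {s | 0 ≤ s ∧ p₀ s ≤ ((s ^ 2 * b₀ : ℝ) : EReal)}.Nonempty)
    (hlim : ∀ s, 0 ≤ s → Tendsto (fun i => p i s) l (𝓝 (p₀ s))) (hb : Tendsto b l (𝓝 b₀)) :
    Tendsto (fun i => crossing (p i) (b i)) l (𝓝 (crossing p₀ b₀)) := by
  have hb' : ∀ s : ℝ, Tendsto (fun i => ((s ^ 2 * b i : ℝ) : EReal)) l
      (𝓝 ((s ^ 2 * b₀ : ℝ) : EReal)) := fun s => EReal.tendsto_coe.2 (hb.const_mul _)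
  refine tendsto_crossing hp ((hb.eventually (lt_mem_nhds hb₀)).mono fun _ => le_of_lt)
    (crossing_nonneg _ _) (fun s hs hst => ?_) fun s hst => ?_
  · exact (hb' s).eventually_lt (hlim s hs) (lt_of_lt_crossing hs hst)
  · exact ((hlim s ((crossing_nonneg _ _).trans hst.le)).eventually_lt (hb' s)
      (lt_of_crossing_lt hp₀ hb₀ hne hst)).mono fun _ => le_of_lt

/-! ### The pressure of `-s log |T'|` -/

/-- The growth rate of `cfSum A n s`, which is the pressure of the potential `-s log |T'|`. -/
def cfPressure (A : Set ℕ) (s : ℝ) : EReal :=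
  limsup (fun n : ℕ => ENNReal.log (cfSum A n s) / (n : EReal)) atTop

lemma log_ofReal_mul_div {x : ℝ} (hx : 0 < x) (Z : ENNReal) (n : ℕ) :
    ENNReal.log (ENNReal.ofReal x * Z) / (n : EReal) =
      ENNReal.log Z / (n : EReal) + ((Real.log x / n : ℝ) : EReal) := by
  rw [ENNReal.log_mul_add, ENNReal.log_ofReal_of_pos hx,
    EReal.add_div_of_nonneg_right (Nat.cast_nonneg' n), add_comm, EReal.coe_div,
    EReal.coe_natCast]

lemma tendsto_add_coe {ι : Type*} {l : Filter ι} {p : ι → EReal} {P : EReal} {c : ι → ℝ} {d : ℝ}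
    (hp : Tendsto p l (𝓝 P)) (hc : Tendsto c l (𝓝 d)) :
    Tendsto (fun i => p i + (c i : EReal)) l (𝓝 (P + (d : EReal))) :=
  (EReal.continuousAt_add (p := (P, (d : EReal))) (Or.inr (EReal.coe_ne_bot d))
    (Or.inr (EReal.coe_ne_top d))).tendsto.comp (hp.prodMk_nhds (EReal.tendsto_coe.2 hc))

lemma add_coe_neg_nonpos_iff {x : EReal} {r : ℝ} :
    x + ((-r : ℝ) : EReal) ≤ 0 ↔ x ≤ (r : EReal) := by
  rw [EReal.coe_neg, ← sub_eq_add_neg, EReal.sub_nonpos]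

/-- The error constant `4 ^ s` is the same for all alphabets, so one fixed `n` controls the pressure
uniformly in `A`. -/
lemma cfPressure_spec {A : Set ℕ} (hA : ∀ a ∈ A, 1 ≤ a) (h1 : 1 ∈ A) {s : ℝ} (hs : 0 ≤ s) :
    Tendsto (fun n : ℕ => ENNReal.log (cfSum A n s) / (n : EReal)) atTop (𝓝 (cfPressure A s)) ∧
      ∀ n : ℕ, 1 ≤ n → cfPressure A s ≤ ENNReal.log (cfSum A n s) / (n : EReal) ∧
        ENNReal.log (cfSum A n s) / (n : EReal) + ((-(Real.log (4 ^ s) / n) : ℝ) : EReal) ≤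
          cfPressure A s := by
  obtain ⟨P, hP, hb⟩ := exists_tendsto_log_div (K := 4 ^ s) (by positivity)
    (fun n => cfSum_ne_zero hA h1 n s) (cfSum_add_le hA hs) (cfSum_mul_le hA hs)
  have : cfPressure A s = P := hP.limsup_eq
  rw [this]
  exact ⟨hP, hb⟩

lemma tendsto_const_div_nat_neg (c : ℝ) : Tendsto (fun n : ℕ => -(c / n)) atTop (𝓝 0) := by
  simpa using (tendsto_const_div_atTop_nhds_zero_nat c).neg

lemma tendsto_pressureSeq {A : Set ℕ} (hA : ∀ a ∈ A, 1 ≤ a) (h1 : 1 ∈ A) {B s : ℝ} (hB : 0 < B)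
    (hs : 0 ≤ s) :
    Tendsto (pressureSeq A (potential B s)) atTop
      (𝓝 (cfPressure A s + ((-(s ^ 2 * Real.log B) : ℝ) : EReal))) := by
  obtain ⟨hlim, -⟩ := cfPressure_spec hA h1 hs
  have hlow := tendsto_add_coe hlim
    ((tendsto_const_nhds (x := -(s ^ 2 * Real.log B))).add
      (tendsto_const_div_nat_neg (s * Real.log 4)))
  rw [add_zero] at hlow
  have hup := tendsto_add_coe hlim (tendsto_const_nhds (x := -(s ^ 2 * Real.log B)))
  have hlogB : ∀ n : ℕ, 1 ≤ n →
      Real.log (B ^ (-(n * s ^ 2))) / n = -(s ^ 2 * Real.log B) := by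
    intro n hn
    have : (n : ℝ) ≠ 0 := by positivity
    rw [Real.log_rpow hB]
    field_simp
  refine tendsto_of_tendsto_of_tendsto_of_le_of_le' hlow hup ?_ ?_
  · filter_upwards [eventually_ge_atTop 1] with n hn
    have h := EReal.div_le_div_right_of_nonneg (Nat.cast_nonneg' n)
      (ENNReal.log_le_log (le_partitionSum hA h1 hB hs n))
    rw [log_ofReal_mul_div (by positivity), log_ofReal_mul_div (by positivity), hlogB n hn,
      Real.log_rpow (by norm_num), add_assoc, ← EReal.coe_add] at h
    rwa [neg_mul, neg_div] at h
  · filter_upwards [eventually_ge_atTop 1] with n hn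
    have h := EReal.div_le_div_right_of_nonneg (Nat.cast_nonneg' n)
      (ENNReal.log_le_log (partitionSum_le hA hB hs n))
    rwa [log_ofReal_mul_div (by positivity), hlogB n hn] at h

lemma pressure_potential {A : Set ℕ} (hA : ∀ a ∈ A, 1 ≤ a) (h1 : 1 ∈ A) {B s : ℝ} (hB : 0 < B)
    (hs : 0 ≤ s) :
    pressure A (potential B s) = cfPressure A s + ((-(s ^ 2 * Real.log B) : ℝ) : EReal) :=
  (tendsto_pressureSeq hA h1 hB hs).limsup_eq

lemma pressureSet_eq {A : Set ℕ} (hA : ∀ a ∈ A, 1 ≤ a) (h1 : 1 ∈ A) {B : ℝ} (hB : 0 < B) :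
    pressureSet A B = {s | 0 ≤ s ∧ cfPressure A s ≤ ((s ^ 2 * Real.log B : ℝ) : EReal)} := by
  ext s
  refine and_congr_right fun hs => ?_
  rw [pressure_potential hA h1 hB hs, add_coe_neg_nonpos_iff]

lemma tDim_eq {A : Set ℕ} (hA : ∀ a ∈ A, 1 ≤ a) (h1 : 1 ∈ A) {B : ℝ} (hB : 0 < B) :
    tDim A B = crossing (cfPressure A) (Real.log B) := by
  rw [tDim, pressureSet_eq hA h1 hB, crossing]

lemma levelSet_eq {A : Set ℕ} (hA : ∀ a ∈ A, 1 ≤ a) {B : ℝ} (hB : 0 < B) {n : ℕ} (hn : 1 ≤ n) :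
    levelSet A B n = {s | 0 ≤ s ∧
      ENNReal.log (cfSum A n s) / (n : EReal) ≤ ((s ^ 2 * Real.log B : ℝ) : EReal)} := by
  ext s
  refine and_congr_right fun hs => ?_
  have hn' : (0 : ℝ) < n := by exact_mod_cast hn
  have hn0 : (0 : EReal) < n := by exact_mod_cast hn
  have hpow : -(s ^ 2 * Real.log B) = Real.log (B ^ (-(n * s ^ 2))) / n := by
    rw [Real.log_rpow hB]
    field_simp
  rw [← add_coe_neg_nonpos_iff, hpow, ← log_ofReal_mul_div (by positivity),
    ← g_eq hA hB, EReal.div_le_iff_le_mul hn0 (EReal.natCast_ne_top _), mul_zero,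
    ENNReal.log_le_zero_iff]

lemma tLevel_eq {A : Set ℕ} (hA : ∀ a ∈ A, 1 ≤ a) {B : ℝ} (hB : 0 < B) {n : ℕ} (hn : 1 ≤ n) :
    tLevel A B n =
      crossing (fun s => ENNReal.log (cfSum A n s) / (n : EReal)) (Real.log B) := by
  rw [tLevel, levelSet_eq hA hB hn, crossing]

lemma antitone_log_cfSum_div {A : Set ℕ} (hA : ∀ a ∈ A, 1 ≤ a) (n : ℕ) :
    Antitone fun s => ENNReal.log (cfSum A n s) / (n : EReal) := fun _ _ h =>
  EReal.div_le_div_right_of_nonneg (Nat.cast_nonneg' n) (ENNReal.log_le_log (cfSum_anti hA n h))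

lemma cfPressure_antitone {A : Set ℕ} (hA : ∀ a ∈ A, 1 ≤ a) : Antitone (cfPressure A) :=
  fun _ _ h => limsup_le_limsup (Eventually.of_forall fun n => antitone_log_cfSum_div hA n h)

lemma log_cfSum_div_mono {A A' : Set ℕ} (h : A ⊆ A') (n : ℕ) (s : ℝ) :
    ENNReal.log (cfSum A n s) / (n : EReal) ≤ ENNReal.log (cfSum A' n s) / (n : EReal) :=
  EReal.div_le_div_right_of_nonneg (Nat.cast_nonneg' n) (ENNReal.log_le_log (cfSum_mono h n s))

lemma cfPressure_mono {A A' : Set ℕ} (h : A ⊆ A') (s : ℝ) : cfPressure A s ≤ cfPressure A' s :=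
  limsup_le_limsup (Eventually.of_forall fun n => log_cfSum_div_mono h n s)

lemma log_cfSum_fullAlphabet_div_le (n : ℕ) :
    ENNReal.log (cfSum fullAlphabet n 1) / (n : EReal) ≤ ((Real.log 2 / n : ℝ) : EReal) := by
  have h := ENNReal.log_le_log (cfSum_fullAlphabet_bounds n).2
  rw [← ENNReal.ofReal_ofNat 2, ENNReal.log_ofReal_of_pos (by norm_num)] at h
  rw [EReal.coe_div, EReal.coe_natCast]
  exact EReal.div_le_div_right_of_nonneg (Nat.cast_nonneg' n) h

lemma cfPressure_fullAlphabet_one : cfPressure fullAlphabet 1 = 0 := by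
  have h2 : Tendsto (fun n : ℕ => ((Real.log 2 / n : ℝ) : EReal)) atTop (𝓝 0) :=
    EReal.tendsto_coe.2 (tendsto_const_div_atTop_nhds_zero_nat _)
  refine (tendsto_of_tendsto_of_tendsto_of_le_of_le tendsto_const_nhds h2 (fun n => ?_)
    log_cfSum_fullAlphabet_div_le).limsup_eq
  exact EReal.div_nonneg (ENNReal.zero_le_log_iff.2 (cfSum_fullAlphabet_bounds n).1)
    (Nat.cast_nonneg' n)

lemma levelSet_nonempty {A : Set ℕ} (hA : ∀ a ∈ A, 1 ≤ a) {B : ℝ} (hB : 1 < B) {n : ℕ}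
    (hn : 1 ≤ n) : (levelSet A B n).Nonempty := by
  have hlB := Real.log_pos hB
  have hl2 := Real.log_pos one_lt_two
  have hn' : (1 : ℝ) ≤ n := by exact_mod_cast hn
  rw [levelSet_eq hA (by linarith) hn]
  -- At `s = 1` the sum may be as large as 2; the second entry makes `s² log B ≥ log 2`, enough for
  -- every `n ≥ 1`.
  set s := max 1 (Real.log 2 / Real.log B)
  have hs1 : 1 ≤ s := le_max_left _ _
  refine ⟨s, by linarith, ?_⟩
  -- Unfolded, `hA` is the inclusion of `A` in the full alphabet.
  refine (antitone_log_cfSum_div hA n hs1).trans ((log_cfSum_div_mono hA n 1).trans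
    ((log_cfSum_fullAlphabet_div_le n).trans (EReal.coe_le_coe_iff.2 ?_)))
  have h2 : Real.log 2 ≤ s * Real.log B := (div_le_iff₀ hlB).1 (le_max_right _ _)
  calc Real.log 2 / n ≤ Real.log 2 := div_le_self hl2.le hn'
    _ ≤ s * Real.log B := h2
    _ ≤ s ^ 2 * Real.log B := by gcongr; nlinarith

lemma pressureSet_nonempty {A : Set ℕ} (hA : ∀ a ∈ A, 1 ≤ a) (h1 : 1 ∈ A) {B : ℝ} (hB : 1 < B) :
    (pressureSet A B).Nonempty := by
  rw [pressureSet_eq hA h1 (by linarith)]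
  refine ⟨1, zero_le_one, (cfPressure_mono hA 1).trans ?_⟩
  change cfPressure fullAlphabet 1 ≤ _
  rw [cfPressure_fullAlphabet_one]
  have := (Real.log_pos hB).le
  exact EReal.coe_nonneg.2 (by positivity)

lemma cfPressure_add_le {A : Set ℕ} (hA : ∀ a ∈ A, 1 ≤ a) (h1 : 1 ∈ A) {s d : ℝ} (hs : 0 ≤ s)
    (hd : 0 ≤ d) :
    cfPressure A (s + d) ≤ cfPressure A s + ((-(d * Real.log 2) : ℝ) : EReal) := by
  have hc : Tendsto (fun n : ℕ => -(d * Real.log 2) + -(-(d * Real.log 2) / n)) atTop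
      (𝓝 (-(d * Real.log 2))) := by
    simpa using (tendsto_const_nhds (x := -(d * Real.log 2))).add
      (tendsto_const_div_nat_neg (-(d * Real.log 2)))
  refine le_of_tendsto_of_tendsto (cfPressure_spec hA h1 (add_nonneg hs hd)).1
    (tendsto_add_coe (cfPressure_spec hA h1 hs).1 hc) ?_
  filter_upwards [eventually_ge_atTop 1] with n hn
  have h := EReal.div_le_div_right_of_nonneg (Nat.cast_nonneg' n)
      (ENNReal.log_le_log (cfSum_add_right_le hA n s hd))
  rw [log_ofReal_mul_div (by positivity), Real.log_rpow (by positivity),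
    Real.log_div (by positivity) (by norm_num), Real.log_pow] at h
  convert h using 3
  have : (n : ℝ) ≠ 0 := by positivity
  field_simp
  ring

/-- The two-sided estimate at `n = 1` reduces finiteness of the pressure to that of `∑ a^{-2s}`,
here and in the next lemma. -/
lemma cfPressure_fullAlphabet_eq_top {s : ℝ} (h0 : 0 ≤ s) (hs : s ≤ 1 / 2) :
    cfPressure fullAlphabet s = ⊤ := by
  have h := ((cfPressure_spec one_le_of_mem_fullAlphabet one_mem_fullAlphabet h0).2 1 le_rfl).2
  rw [cfSum_fullAlphabet_one_eq_top hs, ENNReal.log_top,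
    EReal.top_div_of_pos_ne_top (by simp) (EReal.natCast_ne_top 1), EReal.top_add_coe] at h
  exact top_le_iff.1 h

lemma cfPressure_fullAlphabet_lt_top {s : ℝ} (hs : 1 / 2 < s) : cfPressure fullAlphabet s < ⊤ := by
  have h := ((cfPressure_spec one_le_of_mem_fullAlphabet one_mem_fullAlphabet
    (s := s) (by linarith)).2 1 le_rfl).1
  refine h.trans_lt ?_
  rw [EReal.div_lt_iff (by simp) (EReal.natCast_ne_top 1), Nat.cast_one, mul_one,
    ENNReal.log_lt_top_iff, cfSum_one,
    tsum_fullAlphabet fun a => ENNReal.ofReal ((a : ℝ) ^ (-2 * s))]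
  refine lt_top_iff_ne_top.2 (Summable.tsum_ofReal_ne_top ?_)
  rw [summable_nat_add_iff (f := fun n : ℕ => (n : ℝ) ^ (-2 * s)) 1, Real.summable_nat_rpow]
  linarith

lemma tendsto_cfPressure_finAlphabet {s : ℝ} (hs : 0 ≤ s) :
    Tendsto (fun M => cfPressure (finAlphabet M) s) atTop (𝓝 (cfPressure fullAlphabet s)) := by
  refine tendsto_order.2 ⟨fun c hc => ?_, fun c hc => Eventually.of_forall fun M =>
    (cfPressure_mono (finAlphabet_subset M) s).trans_lt hc⟩
  have h := tendsto_add_coe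
    (cfPressure_spec one_le_of_mem_fullAlphabet one_mem_fullAlphabet hs).1
    (tendsto_const_div_nat_neg (Real.log (4 ^ s)))
  rw [EReal.coe_zero, add_zero] at h
  -- One `n` is fixed for which the lower estimate on the full alphabet exceeds `c`; then `M` is
  -- taken large for this `n` alone.
  obtain ⟨n, hcn, hn⟩ := ((h.eventually (lt_mem_nhds hc)).and (eventually_ge_atTop 1)).exists
  have hdiv : Tendsto (fun M => ENNReal.log (cfSum (finAlphabet M) n s) / (n : EReal)) atTop
      (𝓝 (ENNReal.log (cfSum fullAlphabet n s) / (n : EReal))) := by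
    -- Division by `n` is multiplication by a finite real, so continuity holds even when the limit
    -- is infinite.
    have := EReal.Tendsto.mul_const (b := (((n : ℝ)⁻¹ : ℝ) : EReal))
      ((ENNReal.continuous_log.tendsto _).comp (tendsto_cfSum_finAlphabet n s))
      (Or.inr (EReal.coe_ne_bot _)) (Or.inr (EReal.coe_ne_top _))
    simpa [EReal.coe_inv, div_eq_mul_inv] using this
  filter_upwards [(tendsto_add_coe hdiv tendsto_const_nhds).eventually (lt_mem_nhds hcn),
    eventually_ge_atTop 1] with M h1 h2
  exact h1.trans_le
    ((cfPressure_spec one_le_of_mem_finAlphabet (one_mem_finAlphabet h2) hs).2 n hn).2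

/-! ### Convergence of the crossing points -/

lemma tendsto_tLevel {A : Set ℕ} (hA : ∀ a ∈ A, 1 ≤ a) (h1 : 1 ∈ A) {B : ℝ} (hB : 1 < B) :
    Tendsto (fun n => tLevel A B n) atTop (𝓝 (tDim A B)) := by
  have hB0 : 0 < B := by linarith
  have hne := pressureSet_nonempty hA h1 hB
  rw [pressureSet_eq hA h1 hB0] at hne
  rw [tDim_eq hA h1 hB0]
  refine (tendsto_crossing_of_tendsto
    (Eventually.of_forall fun n => (antitone_log_cfSum_div hA n).antitoneOn _)
    ((cfPressure_antitone hA).antitoneOn _) (Real.log_pos hB) hne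
    (fun s hs => (cfPressure_spec hA h1 hs).1) tendsto_const_nhds).congr' ?_
  filter_upwards [eventually_ge_atTop 1] with n hn
  exact (tLevel_eq hA hB0 hn).symm

lemma crossing_cfPressure_fullAlphabet_nonempty {B : ℝ} (hB : 1 < B) :
    {s | 0 ≤ s ∧ cfPressure fullAlphabet s ≤ ((s ^ 2 * Real.log B : ℝ) : EReal)}.Nonempty := by
  rw [← pressureSet_eq one_le_of_mem_fullAlphabet one_mem_fullAlphabet (by linarith)]
  exact pressureSet_nonempty one_le_of_mem_fullAlphabet one_mem_fullAlphabet hB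

lemma tDim_fullAlphabet {B : ℝ} (hB : 1 < B) :
    tDim fullAlphabet B = crossing (cfPressure fullAlphabet) (Real.log B) :=
  tDim_eq one_le_of_mem_fullAlphabet one_mem_fullAlphabet (by linarith)

lemma antitoneOn_cfPressure_fullAlphabet : AntitoneOn (cfPressure fullAlphabet) (Set.Ici 0) :=
  (cfPressure_antitone one_le_of_mem_fullAlphabet).antitoneOn _

lemma tendsto_tDim_finAlphabet {B : ℝ} (hB : 1 < B) :
    Tendsto (fun M => tDim (finAlphabet M) B) atTop (𝓝 (tDim fullAlphabet B)) := by
  rw [tDim_fullAlphabet hB]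
  refine (tendsto_crossing_of_tendsto
    (Eventually.of_forall fun M => (cfPressure_antitone one_le_of_mem_finAlphabet).antitoneOn _)
    antitoneOn_cfPressure_fullAlphabet (Real.log_pos hB)
    (crossing_cfPressure_fullAlphabet_nonempty hB)
    (fun s hs => tendsto_cfPressure_finAlphabet hs) tendsto_const_nhds).congr' ?_
  filter_upwards [eventually_ge_atTop 1] with M hM
  exact (tDim_eq one_le_of_mem_finAlphabet (one_mem_finAlphabet hM) (by linarith)).symm

lemma continuousOn_tDim_fullAlphabet :
    ContinuousOn (fun B => tDim fullAlphabet B) (Set.Ioi 1) := by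
  intro B (hB : 1 < B)
  have hlog : Tendsto Real.log (𝓝[Set.Ioi 1] B) (𝓝 (Real.log B)) :=
    (Real.continuousAt_log (by linarith)).tendsto.mono_left nhdsWithin_le_nhds
  rw [ContinuousWithinAt, tDim_fullAlphabet hB]
  refine (tendsto_crossing_of_tendsto
    (Eventually.of_forall fun _ => antitoneOn_cfPressure_fullAlphabet)
    antitoneOn_cfPressure_fullAlphabet (Real.log_pos hB)
    (crossing_cfPressure_fullAlphabet_nonempty hB)
    (fun s _ => tendsto_const_nhds) hlog).congr' ?_
  filter_upwards [self_mem_nhdsWithin] with B' hB'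
  exact (tDim_fullAlphabet hB').symm

lemma tendsto_tDim_fullAlphabet_one :
    Tendsto (fun B => tDim fullAlphabet B) (𝓝[>] 1) (𝓝 1) := by
  have hlog : Tendsto Real.log (𝓝[>] 1) (𝓝 0) := by
    have := (Real.continuousAt_log one_ne_zero).tendsto.mono_left
      (nhdsWithin_le_nhds (s := Set.Ioi 1))
    rwa [Real.log_one] at this
  have hpos : ∀ᶠ B : ℝ in 𝓝[>] 1, 0 ≤ Real.log B := by
    filter_upwards [self_mem_nhdsWithin] with B hB
    exact (Real.log_pos hB).le
  have hcross : Tendsto (fun B => crossing (cfPressure fullAlphabet) (Real.log B)) (𝓝[>] 1)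
      (𝓝 1) := by
    refine tendsto_crossing (Eventually.of_forall fun _ => antitoneOn_cfPressure_fullAlphabet)
      hpos zero_le_one (fun s hs hs1 => ?_) fun s hs => ?_
    -- For `s < 1` the slope bound and `P(1) = 0` give `P(s) ≥ (1 - s) log 2 > 0`, while `s² log B`
    -- tends to 0.
    · have h := cfPressure_add_le one_le_of_mem_fullAlphabet one_mem_fullAlphabet hs
        (sub_nonneg.2 hs1.le)
      rw [add_sub_cancel, cfPressure_fullAlphabet_one, EReal.coe_neg, ← sub_eq_add_neg,
        EReal.sub_nonneg (Or.inr (EReal.coe_ne_top _)) (Or.inr (EReal.coe_ne_bot _))] at h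
      have h2 : s ^ 2 * 0 < (1 - s) * Real.log 2 := by
        rw [mul_zero]
        exact mul_pos (sub_pos.2 hs1) (Real.log_pos one_lt_two)
      filter_upwards [(hlog.const_mul (s ^ 2)).eventually (gt_mem_nhds h2)] with B hB
      exact (EReal.coe_lt_coe_iff.2 hB).trans_le h
    · filter_upwards [hpos] with B hB
      refine (cfPressure_antitone one_le_of_mem_fullAlphabet hs.le).trans ?_
      rw [cfPressure_fullAlphabet_one]
      exact EReal.coe_nonneg.2 (by positivity)
  refine hcross.congr' ?_
  filter_upwards [self_mem_nhdsWithin] with B hB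
  exact (tDim_fullAlphabet hB).symm

lemma tendsto_tDim_fullAlphabet_atTop :
    Tendsto (fun B => tDim fullAlphabet B) atTop (𝓝 (1 / 2)) := by
  have hcross : Tendsto (fun B => crossing (cfPressure fullAlphabet) (Real.log B)) atTop
      (𝓝 (1 / 2)) := by
    refine tendsto_crossing (Eventually.of_forall fun _ => antitoneOn_cfPressure_fullAlphabet)
      (Real.tendsto_log_atTop.eventually_ge_atTop 0) (by norm_num) (fun s hs hs1 => ?_)
      fun s hs => ?_
    · refine Eventually.of_forall fun B => ?_
      rw [cfPressure_fullAlphabet_eq_top hs hs1.le]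
      exact EReal.coe_lt_top _
    -- For `s > 1/2` the pressure is below some real `c`, which `s² log B` eventually exceeds.
    · obtain ⟨c, hc, -⟩ := EReal.lt_iff_exists_real_btwn.1 (cfPressure_fullAlphabet_lt_top hs)
      have hs2 : 0 < s ^ 2 := by
        have : 0 < s := by linarith
        positivity
      filter_upwards [(Real.tendsto_log_atTop.const_mul_atTop hs2).eventually_ge_atTop c] with B hB
      exact hc.le.trans (EReal.coe_le_coe_iff.2 hB)
  refine hcross.congr' ?_
  filter_upwards [eventually_gt_atTop 1] with B hB
  exact (tDim_fullAlphabet hB).symm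

end CFPressure

end

/-- The first two conjuncts say that the quantities are well defined: the infima are over non-empty
sets, and the limits that define the pressures exist. The others are the convergence of
`t_{n,B}(M)` to `t_B(M)` and of `t_B(M)` to `t_B`, the continuity of `t_B` on `1 < B < ∞`, and its
limits as `B → 1` and as `B → ∞`. -/
theorem mainTheorem3 :
    (∀ B : ℝ, 1 < B →
      (∀ M : ℕ, 1 ≤ M →
        (∀ n : ℕ, 1 ≤ n → (CFPressure.levelSet (CFPressure.finAlphabet M) B n).Nonempty) ∧
        (CFPressure.pressureSet (CFPressure.finAlphabet M) B).Nonempty) ∧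
      (CFPressure.pressureSet CFPressure.fullAlphabet B).Nonempty) ∧
    (∀ B : ℝ, 1 < B → ∀ s : ℝ, 0 ≤ s →
      (∀ M : ℕ, 1 ≤ M →
        Tendsto
          (CFPressure.pressureSeq (CFPressure.finAlphabet M) (CFPressure.potential B s)) atTop
          (𝓝 (CFPressure.pressure (CFPressure.finAlphabet M) (CFPressure.potential B s)))) ∧
      Tendsto
        (CFPressure.pressureSeq CFPressure.fullAlphabet (CFPressure.potential B s)) atTop
        (𝓝 (CFPressure.pressure CFPressure.fullAlphabet (CFPressure.potential B s)))) ∧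
    (∀ B : ℝ, 1 < B → ∀ M : ℕ, 1 ≤ M →
      Tendsto (fun n : ℕ => CFPressure.tLevel (CFPressure.finAlphabet M) B n) atTop
        (𝓝 (CFPressure.tDim (CFPressure.finAlphabet M) B))) ∧
    (∀ B : ℝ, 1 < B →
      Tendsto (fun M : ℕ => CFPressure.tDim (CFPressure.finAlphabet M) B) atTop
        (𝓝 (CFPressure.tDim CFPressure.fullAlphabet B))) ∧
    ContinuousOn (fun B : ℝ => CFPressure.tDim CFPressure.fullAlphabet B) (Set.Ioi 1) ∧
    Tendsto (fun B : ℝ => CFPressure.tDim CFPressure.fullAlphabet B) (𝓝[>] 1) (𝓝 1) ∧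
    Tendsto (fun B : ℝ => CFPressure.tDim CFPressure.fullAlphabet B) atTop (𝓝 (1 / 2)) := by
  refine ⟨fun B hB => ⟨fun M hM => ⟨fun n hn => ?_, ?_⟩, ?_⟩, fun B hB s hs => ⟨fun M hM => ?_, ?_⟩,
    fun B hB M hM => ?_, fun B hB => CFPressure.tendsto_tDim_finAlphabet hB,
    CFPressure.continuousOn_tDim_fullAlphabet, CFPressure.tendsto_tDim_fullAlphabet_one,
    CFPressure.tendsto_tDim_fullAlphabet_atTop⟩
  · exact CFPressure.levelSet_nonempty CFPressure.one_le_of_mem_finAlphabet hB hn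
  · exact CFPressure.pressureSet_nonempty CFPressure.one_le_of_mem_finAlphabet
      (CFPressure.one_mem_finAlphabet hM) hB
  · exact CFPressure.pressureSet_nonempty CFPressure.one_le_of_mem_fullAlphabet
      CFPressure.one_mem_fullAlphabet hB
  · have h := CFPressure.tendsto_pressureSeq CFPressure.one_le_of_mem_finAlphabet
      (CFPressure.one_mem_finAlphabet hM) (zero_lt_one.trans hB) hs
    rwa [← CFPressure.pressure_potential CFPressure.one_le_of_mem_finAlphabet
      (CFPressure.one_mem_finAlphabet hM) (zero_lt_one.trans hB) hs] at h
  · have h := CFPressure.tendsto_pressureSeq CFPressure.one_le_of_mem_fullAlphabet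
      CFPressure.one_mem_fullAlphabet (zero_lt_one.trans hB) hs
    rwa [← CFPressure.pressure_potential CFPressure.one_le_of_mem_fullAlphabet
      CFPressure.one_mem_fullAlphabet (zero_lt_one.trans hB) hs] at h
  · exact CFPressure.tendsto_tLevel CFPressure.one_le_of_mem_finAlphabet
      (CFPressure.one_mem_finAlphabet hM) hB
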